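/- Let $G$ be a finitely generated free abelian group. A *convex cone* in $G$ is a finitely generated saturated submonoid $P\subseteq G$ whose only invertible element is $0$ and such that $G/P^{\mathrm{gp}}$ is torsion free, where $P^{\mathrm{gp}}$ is the subgroup of $G$ generated by $P$ (*saturated*: if $x\in P^{\mathrm{gp}}$ and $nx\in P$ for some integer $n\ge 1$, then $x\in P$). A *prime ideal* of a commutative monoid $P$ is a (possibly empty) subset $\mathfrak p\subseteq P$ with $P+\mathfrak p\subseteq\mathfrak p$ whose complement $P-\mathfrak p$ is a submonoid. A *fan* in $G$ is a nonempty set $\triangle$ of convex cones in $G$ such that (i) $P-\mathfrak p\in\triangle$ for all $P\in\triangle$ and all prime ideals $\mathfrak p$ of $P$; (ii) for all $P,Q\in\triangle$ there are prime ideals $\mathfrak p$ of $P$ and $\mathfrak q$ of $Q$ with $P\cap Q=P-\mathfrak p=Q-\mathfrak q$. For a commutative ring $R$ and $P\in\triangle$ put $\check P=\{\sigma\in\mathrm{Hom}(G,\mathbb Z) : \sigma(x)\ge 0 \text{ for all } x\in P\}$ and $U_P=\operatorname{Spec}R[\check P]$. Let $X_\triangle(R)$ be the toric scheme over $R$ obtained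 by gluing the $U_P$ $(P\in\triangle)$ along the open subschemes $U_{P\cap Q}$ of $U_P$ and $U_Q$ $(P,Q\in\triangle)$. **Theorem.** Let $R$ be a nonzero noetherian commutative ring and $\triangle$ a fan in $G$. Then the following conditions are equivalent: 1. $X_\triangle(R)$ is quasi-compact; 2. $X_\triangle(R)$ is a noetherian scheme; 3. $\triangle$ is a finite set. -/

import Mathlib

universe u v

namespace ToricScheme

open CategoryTheory CategoryTheory.Limits AlgebraicGeometry

/-! ### Prime ideals and faces of (additive) monoids -/

/-- An ideal of a commutative monoid (possibly empty) is prime if its complement is a submonoid. -/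
structure IsPrimeIdeal {M : Type v} [AddCommMonoid M] (p : AddSemigroupIdeal M) : Prop where
  zero_notMem : (0 : M) ∉ p
  add_notMem : ∀ {x y : M}, x ∉ p → y ∉ p → x + y ∉ p

/-- The submonoid `M - p` of `M`, for a prime ideal `p` of `M`. -/
def IsPrimeIdeal.compl {M : Type v} [AddCommMonoid M] {p : AddSemigroupIdeal M}
    (hp : IsPrimeIdeal p) : AddSubmonoid M where
  carrier := {x | x ∉ p}
  zero_mem' := hp.zero_notMem
  add_mem' := hp.add_notMem

section Lattice

variable {G : Type v} [AddCommGroup G]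

/-- `F = P - p` for some prime ideal `p` of the monoid `P`; everything is viewed inside `G`. -/
def IsFace (F P : AddSubmonoid G) : Prop :=
  ∃ (p : AddSemigroupIdeal P) (hp : IsPrimeIdeal p), F = hp.compl.map P.subtype

/-- A convex cone in `G`: a finitely generated saturated submonoid `P` of `G` without nonzero
invertible elements, such that `G / P^gp` is torsion free.  The Grothendieck group `P^gp` is the
subgroup of `G` generated by `P`. -/
structure IsConvexCone (P : AddSubmonoid G) : Prop where
  fg : P.FG
  saturated : ∀ x ∈ AddSubgroup.closure (P : Set G), ∀ n : ℕ, 0 < n → n • x ∈ P → x ∈ P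
  sharp : ∀ x ∈ P, -x ∈ P → x = 0
  torsionFree : IsAddTorsionFree (G ⧸ AddSubgroup.closure (P : Set G))

/-- The dual monoid of `P`, in the dual group `Hom(G, ℤ)`: all homomorphisms that are nonnegative
on `P`. -/
def dualCone (P : AddSubmonoid G) : AddSubmonoid (G →ₗ[ℤ] ℤ) where
  carrier := {σ | ∀ x ∈ P, 0 ≤ σ x}
  zero_mem' := fun _ _ => le_rfl
  add_mem' := fun ha hb x hx => add_nonneg (ha x hx) (hb x hx)

lemma dualCone_anti {P Q : AddSubmonoid G} (h : P ≤ Q) : dualCone Q ≤ dualCone P :=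
  fun _ hσ x hx => hσ x (h hx)

variable (G) in
/-- A fan in `G`: a nonempty set of convex cones in `G`, closed under passing to faces, such that
any two members meet in a common face. -/
structure Fan where
  cones : Set (AddSubmonoid G)
  nonempty : cones.Nonempty
  isConvexCone : ∀ P ∈ cones, IsConvexCone P
  face_mem : ∀ P ∈ cones, ∀ F : AddSubmonoid G, IsFace F P → F ∈ cones
  inter_isFace : ∀ P ∈ cones, ∀ Q ∈ cones, IsFace (P ⊓ Q) P ∧ IsFace (P ⊓ Q) Q

/-! ### Supporting functionals of faces -/

lemma IsFace.le {F P : AddSubmonoid G} (h : IsFace F P) : F ≤ P := by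
  obtain ⟨p, hp, rfl⟩ := h
  rintro _ ⟨x, -, rfl⟩
  exact x.2

lemma IsFace.mem_left {F P : AddSubmonoid G} (h : IsFace F P) {x y : G} (hx : x ∈ P) (hy : y ∈ P)
    (hxy : x + y ∈ F) : x ∈ F := by
  obtain ⟨p, hp, rfl⟩ := h
  obtain ⟨z, hz, hzxy⟩ := hxy
  refine ⟨⟨x, hx⟩, fun hxp => hz ?_, rfl⟩
  have hz' : z = (⟨y, hy⟩ : P) + ⟨x, hx⟩ := by
    apply Subtype.ext
    simpa [add_comm] using hzxy
  rw [hz']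
  exact p.vadd_mem' (⟨y, hy⟩ : P) hxp

/-- If no element of the finite set `T` is invertible in the monoid generated by `T`, then some
homomorphism to `ℚ` is positive on `T`. -/
lemma exists_pos_of_finite (T : Finset ℕ) : ∀ {H : Type v} [AddCommGroup H] (f : ℕ → H),
    (∀ i ∈ T, -f i ∉ AddSubmonoid.closure (f '' T)) → ∃ φ : H →+ ℚ, ∀ i ∈ T, 0 < φ (f i) := by
  induction T using Finset.induction_on with
  | empty => exact fun _ _ => ⟨0, by simp⟩
  | insert a T ha ih =>
    intro H _ f hT
    have hsub : AddSubmonoid.closure (f '' T) ≤ AddSubmonoid.closure (f '' (insert a T : Finset ℕ)) :=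
      AddSubmonoid.closure_mono (Set.image_mono (by simp))
    have hamem : f a ∈ AddSubmonoid.closure (f '' (insert a T : Finset ℕ)) :=
      AddSubmonoid.subset_closure ⟨a, by simp, rfl⟩
    let π := QuotientAddGroup.mk' (AddSubgroup.zmultiples (f a))
    by_cases hq : ∀ i ∈ T, -(π (f i)) ∉ AddSubmonoid.closure ((fun j => π (f j)) '' T)
    · obtain ⟨φ, hφ⟩ := ih (fun j => π (f j)) hq
      have hinj : Function.Injective (zmultiplesHom H (f a)) := by
        rw [injective_iff_map_eq_zero]
        have key : ∀ n : ℕ, n • f a = 0 → n = 0 := by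
          intro n hn
          by_contra h0
          obtain ⟨m, rfl⟩ := Nat.exists_eq_succ_of_ne_zero h0
          apply hT a (by simp)
          rw [Nat.succ_eq_add_one, add_smul, one_smul] at hn
          rw [neg_eq_of_add_eq_zero_left hn]
          exact AddSubmonoid.nsmul_mem _ hamem m
        intro n hn
        rw [zmultiplesHom_apply] at hn
        have := key n.natAbs (by
          rcases Int.natAbs_eq n with h | h
          · rw [h] at hn; simpa using hn
          · rw [h] at hn; simpa using hn)
        simpa using this
      obtain ⟨ψ, hψ⟩ := (Module.Baer.of_divisible ℚ).extension_property_addMonoidHom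
        (zmultiplesHom H (f a)) hinj (Int.castAddHom ℚ)
      have hψa : ψ (f a) = 1 := by
        have := DFunLike.congr_fun hψ 1
        simpa using this
      obtain ⟨N, hN⟩ : ∃ N : ℕ, ∀ i ∈ T, 0 < (N : ℚ) * φ (π (f i)) + ψ (f i) := by
        have hev : ∀ᶠ N : ℕ in Filter.atTop, ∀ i ∈ T, 0 < (N : ℚ) * φ (π (f i)) + ψ (f i) := by
          rw [Filter.eventually_all_finset]
          intro i hi
          have h1 : Filter.Tendsto (fun N : ℕ => (N : ℚ) * φ (π (f i)) + ψ (f i))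
              Filter.atTop Filter.atTop :=
            Filter.tendsto_atTop_add_const_right _ _
              (tendsto_natCast_atTop_atTop.atTop_mul_const (hφ i hi))
          exact h1.eventually_gt_atTop 0
        exact hev.exists
      refine ⟨N • (φ.comp π) + ψ, fun i hi => ?_⟩
      rw [Finset.mem_insert] at hi
      rcases hi with rfl | hi
      · have : π (f i) = 0 := (QuotientAddGroup.eq_zero_iff _).2 (AddSubgroup.mem_zmultiples _)
        simp [this, hψa]
      · simpa using hN i hi
    · push Not at hq
      obtain ⟨t, ht, htc⟩ := hq
      obtain ⟨φ, hφ⟩ := ih f (fun i hi h => hT i (by simp [hi]) (hsub h))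
      have himg : (fun j => π (f j)) '' T = π '' (f '' T) := (Set.image_image _ _ _).symm
      rw [himg, ← AddMonoidHom.map_mclosure] at htc
      obtain ⟨y, hy, hyt⟩ := htc
      have hker : f t + y ∈ AddSubgroup.zmultiples (f a) := by
        rw [← QuotientAddGroup.eq_zero_iff]
        change π (f t + y) = 0
        rw [map_add, hyt, add_neg_cancel]
      obtain ⟨l, hl⟩ := AddSubgroup.mem_zmultiples_iff.1 hker
      have hφ0 : ∀ w ∈ AddSubmonoid.closure (f '' T), 0 ≤ φ w := by
        intro w hw
        induction hw using AddSubmonoid.closure_induction with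
        | mem x hx => obtain ⟨i, hi, rfl⟩ := hx; exact (hφ i hi).le
        | zero => simp
        | add x z _ _ hx hz => rw [map_add]; exact add_nonneg hx hz
      have hφy : 0 ≤ φ y := hφ0 y hy
      have hlpos : 0 < l := by
        by_contra hle
        push Not at hle
        apply hT t (by simp [ht])
        have : -f t = y + (-l).toNat • f a := by
          have h2 : ((-l).toNat : ℤ) • f a = -(f t + y) := by
            rw [Int.toNat_of_nonneg (by omega), neg_smul, hl]
          rw [← natCast_zsmul, h2]
          abel
        rw [this]
        exact add_mem (hsub hy) (AddSubmonoid.nsmul_mem _ hamem _)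
      refine ⟨φ, fun i hi => ?_⟩
      rw [Finset.mem_insert] at hi
      rcases hi with rfl | hi
      · have h3 : (l : ℚ) * φ (f i) = φ (f t) + φ y := by
          rw [← map_add, ← hl, map_zsmul, zsmul_eq_mul]
        have h4 : 0 < (l : ℚ) * φ (f i) := by
          rw [h3]; exact add_pos_of_pos_of_nonneg (hφ t ht) hφy
        exact (pos_iff_pos_of_mul_pos h4).1 (by exact_mod_cast hlpos)
      · exact hφ i hi

/-- `σ` is nonnegative on `P` and vanishes exactly on the subset `F` of `P`. -/
structure IsSupporting (σ : G →ₗ[ℤ] ℤ) (F P : AddSubmonoid G) : Prop where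
  eq_zero : ∀ x ∈ F, σ x = 0
  pos : ∀ x ∈ P, x ∉ F → 0 < σ x

lemma IsSupporting.mem_dualCone {σ : G →ₗ[ℤ] ℤ} {F P : AddSubmonoid G} (h : IsSupporting σ F P) :
    σ ∈ dualCone P := by
  intro x hx
  by_cases hF : x ∈ F
  · exact (h.eq_zero x hF).ge
  · exact (h.pos x hx hF).le

lemma IsSupporting.inf {σ τ : G →ₗ[ℤ] ℤ} {E F P : AddSubmonoid G} (hσ : IsSupporting σ E P)
    (hτ : IsSupporting τ F P) : IsSupporting (σ + τ) (E ⊓ F) P where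
  eq_zero x hx := by
    rw [LinearMap.add_apply, hσ.eq_zero x hx.1, hτ.eq_zero x hx.2, add_zero]
  pos x hx hEF := by
    rw [LinearMap.add_apply]
    by_cases hE : x ∈ E
    · exact add_pos_of_nonneg_of_pos (hσ.mem_dualCone x hx) (hτ.pos x hx fun hF => hEF ⟨hE, hF⟩)
    · exact add_pos_of_pos_of_nonneg (hσ.pos x hx hE) (hτ.mem_dualCone x hx)

/-- Every face of a finitely generated monoid in a lattice has a supporting functional. -/
lemma IsFace.exists_isSupporting [Module.Free ℤ G] [Module.Finite ℤ G] {F P : AddSubmonoid G}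
    (hP : P.FG) (h : IsFace F P) : ∃ σ : G →ₗ[ℤ] ℤ, IsSupporting σ F P := by
  classical
  obtain ⟨S, rfl⟩ := hP
  -- a homomorphism to `ℚ` vanishing on `F`, positive on the generators outside `F`
  obtain ⟨φ, hφF, hφS⟩ : ∃ φ : G →+ ℚ, (∀ x ∈ F, φ x = 0) ∧ ∀ x ∈ S, x ∉ F → 0 < φ x := by
    let π := QuotientAddGroup.mk' (AddSubgroup.closure (F : Set G))
    let S' := S.filter (· ∉ F)
    obtain ⟨g, hg⟩ : ∃ g : ℕ → G, g '' (Finset.range S'.card : Finset ℕ) = S' := by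
      refine ⟨fun n => if hn : n < S'.card then (S'.equivFin.symm ⟨n, hn⟩ : G) else 0, ?_⟩
      ext x
      constructor
      · rintro ⟨n, hn, rfl⟩
        have hn' : n < S'.card := by simpa using hn
        simp only [hn', dif_pos]
        exact (S'.equivFin.symm ⟨n, hn'⟩).2
      · intro hx
        refine ⟨S'.equivFin ⟨x, hx⟩, by simp, by simp⟩
    have hmem : ∀ i ∈ Finset.range S'.card, g i ∈ S' := by
      intro i hi
      have : g i ∈ g '' (Finset.range S'.card : Finset ℕ) := ⟨i, hi, rfl⟩
      rw [hg] at this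
      exact this
    obtain ⟨φ, hφ⟩ := exists_pos_of_finite (Finset.range S'.card) (fun i => π (g i)) (by
      intro i hi hneg
      have himg : (fun j => π (g j)) '' (Finset.range S'.card : Finset ℕ) = π '' S' := by
        rw [← hg, Set.image_image]
      rw [himg, ← AddMonoidHom.map_mclosure] at hneg
      obtain ⟨y, hy, hyi⟩ := hneg
      have hyP : y ∈ AddSubmonoid.closure (S : Set G) :=
        AddSubmonoid.closure_mono (Finset.coe_subset.2 (Finset.filter_subset _ _)) hy
      have hgi := Finset.mem_filter.1 (hmem i hi)
      have hgP : g i ∈ AddSubmonoid.closure (S : Set G) := AddSubmonoid.subset_closure hgi.1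
      have hk : g i + y ∈ AddSubgroup.closure (F : Set G) := by
        rw [← QuotientAddGroup.eq_zero_iff]
        change π (g i + y) = 0
        rw [map_add, hyi, add_neg_cancel]
      have hdiff : ∀ z ∈ AddSubgroup.closure (F : Set G), ∃ a ∈ F, z + a ∈ F := by
        intro z hz
        induction hz using AddSubgroup.closure_induction with
        | mem x hx => exact ⟨0, F.zero_mem, by simpa using hx⟩
        | zero => exact ⟨0, F.zero_mem, by simp⟩
        | add x y _ _ hx hy =>
          obtain ⟨a, ha, hxa⟩ := hx
          obtain ⟨b, hb, hyb⟩ := hy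
          refine ⟨a + b, add_mem ha hb, ?_⟩
          rw [add_add_add_comm]
          exact add_mem hxa hyb
        | neg x _ hx =>
          obtain ⟨a, ha, hxa⟩ := hx
          exact ⟨x + a, hxa, by simpa using ha⟩
      obtain ⟨a, ha, hza⟩ := hdiff _ hk
      rw [add_assoc] at hza
      exact hgi.2 (h.mem_left hgP (add_mem hyP (h.le ha)) hza))
    refine ⟨φ.comp π, fun x hx => ?_, fun x hx hxF => ?_⟩
    · have : π x = 0 := (QuotientAddGroup.eq_zero_iff _).2 (AddSubgroup.subset_closure hx)
      simp [this]
    · have hx' : x ∈ g '' (Finset.range S'.card : Finset ℕ) := by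
        rw [hg]; simp [S', hx, hxF]
      obtain ⟨i, hi, rfl⟩ := hx'
      exact hφ i hi
  -- clear denominators
  obtain ⟨N, hN, σ, hσ⟩ : ∃ N : ℚ, 0 < N ∧ ∃ σ : G →ₗ[ℤ] ℤ, ∀ x, (σ x : ℚ) = N * φ x := by
    let b := Module.Free.chooseBasis ℤ G
    let N : ℕ := ∏ i, (φ (b i)).den
    have hint : ∀ i, ∃ m : ℤ, (m : ℚ) = (N : ℚ) * φ (b i) := by
      intro i
      obtain ⟨c, hc⟩ : (φ (b i)).den ∣ N := Finset.dvd_prod_of_mem _ (Finset.mem_univ i)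
      refine ⟨c * (φ (b i)).num, ?_⟩
      rw [hc]
      push_cast
      rw [mul_comm ((φ (b i)).den : ℚ), mul_assoc, Rat.den_mul_eq_num]
    choose m hm using hint
    refine ⟨N, ?_, b.constr ℤ m, ?_⟩
    · have : 0 < N := Finset.prod_pos fun i _ => (φ (b i)).den_pos
      exact_mod_cast this
    · intro x
      have hlin : (Int.castAddHom ℚ).toIntLinearMap.comp (b.constr ℤ m)
          = ((AddMonoidHom.mulLeft (N : ℚ)).comp φ).toIntLinearMap := by
        refine b.ext fun i => ?_
        simp [hm]
      simpa using LinearMap.congr_fun hlin x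
  have hσ0 : ∀ x ∈ AddSubmonoid.closure (S : Set G), 0 ≤ φ x ∧ (φ x = 0 → x ∈ F) := by
    intro x hx
    induction hx using AddSubmonoid.closure_induction with
    | mem x hx =>
      by_cases hxF : x ∈ F
      · exact ⟨(hφF x hxF).ge, fun _ => hxF⟩
      · exact ⟨(hφS x hx hxF).le, fun h0 => absurd h0 (hφS x hx hxF).ne'⟩
    | zero => exact ⟨by simp, fun _ => F.zero_mem⟩
    | add x y _ _ hx hy =>
      rw [map_add]
      refine ⟨add_nonneg hx.1 hy.1, fun h0 => ?_⟩
      exact add_mem (hx.2 (by linarith [hx.1, hy.1])) (hy.2 (by linarith [hx.1, hy.1]))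
  refine ⟨σ, fun x hx => ?_, fun x hx hxF => ?_⟩
  · have := hσ x
    rw [hφF x hx, mul_zero] at this
    exact_mod_cast this
  · have h1 : 0 < φ x := lt_of_le_of_ne (hσ0 x hx).1 fun h0 => hxF ((hσ0 x hx).2 h0.symm)
    have h2 : (0 : ℚ) < σ x := by rw [hσ x]; exact mul_pos hN h1
    exact_mod_cast h2

/-- If `σ` supports the face `F` of `P`, then the dual of `F` is obtained from the dual of `P` by
inverting `σ`. -/
lemma IsSupporting.exists_add_mem {σ : G →ₗ[ℤ] ℤ} {F P : AddSubmonoid G} (hP : P.FG)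
    (h : IsSupporting σ F P) {τ : G →ₗ[ℤ] ℤ} (hτ : τ ∈ dualCone F) :
    ∃ n : ℕ, τ + n • σ ∈ dualCone P := by
  obtain ⟨S, rfl⟩ := hP
  refine ⟨∑ s ∈ S, (τ s).natAbs, fun x hx => ?_⟩
  induction hx using AddSubmonoid.closure_induction with
  | zero => simp
  | add x y _ _ hx hy => rw [map_add]; exact add_nonneg hx hy
  | mem x hx =>
    rw [LinearMap.add_apply, LinearMap.smul_apply, nsmul_eq_mul]
    by_cases hxF : x ∈ F
    · rw [h.eq_zero x hxF, mul_zero, add_zero]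
      exact hτ x hxF
    · have h1 : 0 < σ x := h.pos x (AddSubmonoid.subset_closure hx) hxF
      have h2 : (τ x).natAbs ≤ ∑ s ∈ S, (τ s).natAbs :=
        Finset.single_le_sum (f := fun s => (τ s).natAbs) (fun _ _ => Nat.zero_le _) hx
      have h3 : ((τ x).natAbs : ℤ) ≤ ((∑ s ∈ S, (τ s).natAbs : ℕ) : ℤ) := by exact_mod_cast h2
      have h4 : -τ x ≤ ((τ x).natAbs : ℤ) := by omega
      nlinarith

end Lattice

/-! ### The toric scheme of a fan -/

section Scheme

variable {G : Type v} [AddCommGroup G] (R : Type u) [CommRing R]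

/-- For `P ≤ Q`, the inclusion of monoid algebras `R[Qˇ] → R[Pˇ]`. -/
noncomputable def dualMap {P Q : AddSubmonoid G} (h : P ≤ Q) :
    AddMonoidAlgebra R (dualCone Q) →+* AddMonoidAlgebra R (dualCone P) :=
  AddMonoidAlgebra.mapDomainRingHom R (AddSubmonoid.inclusion (dualCone_anti h))

lemma isLocalization_dualMap {F P : AddSubmonoid G} (hP : P.FG) (hFP : F ≤ P)
    {σ : G →ₗ[ℤ] ℤ} (h : IsSupporting σ F P) :
    @IsLocalization.Away _ _ (AddMonoidAlgebra.single (⟨σ, h.mem_dualCone⟩ : dualCone P) (1 : R))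
      (AddMonoidAlgebra R (dualCone F)) _ (dualMap R hFP).toAlgebra := by
  let := (dualMap R hFP).toAlgebra
  have hs : ∀ (τ : dualCone P) (r : R), algebraMap (AddMonoidAlgebra R (dualCone P))
      (AddMonoidAlgebra R (dualCone F)) (AddMonoidAlgebra.single τ r) =
      AddMonoidAlgebra.single (AddSubmonoid.inclusion (dualCone_anti hFP) τ) r := by
    intro τ r
    rw [RingHom.algebraMap_toAlgebra]
    simp [dualMap]
  have hneg : -σ ∈ dualCone F := fun x hx => by simp [h.eq_zero x hx]
  refine IsLocalization.Away.mk _ ?_ ?_ ?_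
  · rw [hs]
    refine IsUnit.of_mul_eq_one (AddMonoidAlgebra.single (⟨-σ, hneg⟩ : dualCone F) (1 : R)) ?_
    rw [AddMonoidAlgebra.single_mul_single, AddMonoidAlgebra.one_def, one_mul]
    congr 1
    apply Subtype.ext
    simp
  · intro s
    induction s using AddMonoidAlgebra.induction_linear with
    | zero => exact ⟨0, 0, by simp⟩
    | add x y hx hy =>
      obtain ⟨n, a, ha⟩ := hx
      obtain ⟨m, b, hb⟩ := hy
      refine ⟨n + m, a * (AddMonoidAlgebra.single ⟨σ, h.mem_dualCone⟩ 1) ^ m +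
        b * (AddMonoidAlgebra.single ⟨σ, h.mem_dualCone⟩ 1) ^ n, ?_⟩
      rw [map_add, map_mul, map_mul, map_pow, map_pow, ← ha, ← hb]
      ring
    | single τ r =>
      obtain ⟨n, hn⟩ := h.exists_add_mem hP τ.2
      refine ⟨n, AddMonoidAlgebra.single ⟨_, hn⟩ r, ?_⟩
      rw [hs, hs, AddMonoidAlgebra.single_pow, AddMonoidAlgebra.single_mul_single, one_pow, mul_one]
      congr 1
  · intro a b hab
    refine ⟨0, ?_⟩
    rw [AddMonoidAlgebra.mapDomain_injective
      (AddSubmonoid.inclusion_injective (dualCone_anti hFP)) hab]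

/-- The affine toric scheme `U_P = Spec R[Pˇ]`. -/
noncomputable def affineChart (P : AddSubmonoid G) : Scheme.{max u v} :=
  Spec (CommRingCat.of (AddMonoidAlgebra R (dualCone P)))

/-- The morphism `U_P ⟶ U_Q` for `P ≤ Q`. -/
noncomputable def affineChartMap {P Q : AddSubmonoid G} (h : P ≤ Q) :
    affineChart R P ⟶ affineChart R Q :=
  Spec.map (CommRingCat.ofHom (dualMap R h))

lemma isOpenImmersion_affineChartMap [Module.Free ℤ G] [Module.Finite ℤ G]
    {F P : AddSubmonoid G} (hP : P.FG) (hF : IsFace F P) :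
    IsOpenImmersion (affineChartMap R hF.le) := by
  obtain ⟨σ, hσ⟩ := hF.exists_isSupporting hP
  let := (dualMap R hF.le).toAlgebra
  have := isLocalization_dualMap R hP hF.le hσ
  exact IsOpenImmersion.of_isLocalization
    (AddMonoidAlgebra.single (⟨σ, hσ.mem_dualCone⟩ : dualCone P) (1 : R))

lemma range_comap_dualMap {F P : AddSubmonoid G} (hP : P.FG) (hFP : F ≤ P)
    {σ : G →ₗ[ℤ] ℤ} (h : IsSupporting σ F P) :
    Set.range (PrimeSpectrum.comap (dualMap R hFP)) = (PrimeSpectrum.basicOpen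
      (AddMonoidAlgebra.single (⟨σ, h.mem_dualCone⟩ : dualCone P) (1 : R)) : Set _) := by
  let := (dualMap R hFP).toAlgebra
  have := isLocalization_dualMap R hP hFP h
  exact PrimeSpectrum.localization_away_comap_range _ _

/-- Inside `U_P`, one has `U_E ∩ U_F = U_{E ∩ F}` for faces `E`, `F` of `P`. -/
lemma range_affineChartMap_inter [Module.Free ℤ G] [Module.Finite ℤ G]
    {E F P : AddSubmonoid G} (hP : P.FG) (hE : IsFace E P) (hF : IsFace F P) :
    Set.range (affineChartMap R hE.le) ∩ Set.range (affineChartMap R hF.le) =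
      Set.range (affineChartMap R (inf_le_left.trans hE.le : E ⊓ F ≤ P)) := by
  obtain ⟨σ, hσ⟩ := hE.exists_isSupporting hP
  obtain ⟨τ, hτ⟩ := hF.exists_isSupporting hP
  have h1 := range_comap_dualMap R hP hE.le hσ
  have h2 := range_comap_dualMap R hP hF.le hτ
  have h3 := range_comap_dualMap R hP (inf_le_left.trans hE.le) (hσ.inf hτ)
  change Set.range (PrimeSpectrum.comap (dualMap R hE.le)) ∩
    Set.range (PrimeSpectrum.comap (dualMap R hF.le)) =
    Set.range (PrimeSpectrum.comap (dualMap R (inf_le_left.trans hE.le : E ⊓ F ≤ P)))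
  rw [h1, h2, h3, ← TopologicalSpace.Opens.coe_inf, ← PrimeSpectrum.basicOpen_mul,
    AddMonoidAlgebra.single_mul_single, one_mul]
  rfl

namespace Fan

variable (Δ : Fan G)

/-- The diagram of the affine schemes `U_P` and the morphisms `U_P ⟶ U_Q` for `P ⊆ Q`, indexed by
the fan ordered by inclusion. -/
noncomputable def chart : Δ.cones ⥤ Scheme.{max u v} where
  obj P := affineChart R P.1
  map h := affineChartMap R h.le
  map_id P := by
    have h : dualMap R (le_refl P.1) = RingHom.id _ := AddMonoidAlgebra.mapDomainRingHom_id
    change Spec.map (CommRingCat.ofHom (dualMap R (le_refl P.1))) = _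
    rw [h]
    exact Spec.map_id _
  map_comp {P Q K} f g := by
    have h : dualMap R (f.le.trans g.le) = (dualMap R f.le).comp (dualMap R g.le) :=
      AddMonoidAlgebra.mapDomainRingHom_comp
        (AddSubmonoid.inclusion (dualCone_anti f.le)) (AddSubmonoid.inclusion (dualCone_anti g.le))
    change Spec.map (CommRingCat.ofHom (dualMap R (f.le.trans g.le))) = _
    rw [h, CommRingCat.ofHom_comp, Spec.map_comp]
    rfl

variable {Δ} in
lemma isFace_of_le {P Q : AddSubmonoid G} (hP : P ∈ Δ.cones) (hQ : Q ∈ Δ.cones) (h : P ≤ Q) :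
    IsFace P Q := by
  have := (Δ.inter_isFace P hP Q hQ).2
  rwa [inf_eq_left.2 h] at this

lemma inf_mem {P Q : AddSubmonoid G} (hP : P ∈ Δ.cones) (hQ : Q ∈ Δ.cones) :
    P ⊓ Q ∈ Δ.cones :=
  Δ.face_mem P hP _ (Δ.inter_isFace P hP Q hQ).1

variable [Module.Free ℤ G] [Module.Finite ℤ G]

instance {P Q : Δ.cones} (f : P ⟶ Q) : IsOpenImmersion ((Δ.chart R).map f) :=
  isOpenImmersion_affineChartMap R (Δ.isConvexCone _ Q.2).fg (isFace_of_le P.2 Q.2 f.le)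

instance : (Δ.chart R ⋙ Scheme.forget).IsLocallyDirected where
  cond {P Q K} fP fQ x y hxy := by
    have hP := isFace_of_le P.2 K.2 fP.le
    have hQ := isFace_of_le Q.2 K.2 fQ.le
    let L : Δ.cones := ⟨P.1 ⊓ Q.1, Δ.inf_mem P.2 Q.2⟩
    let gP : L ⟶ P := homOfLE (inf_le_left : P.1 ⊓ Q.1 ≤ P.1)
    let gQ : L ⟶ Q := homOfLE (inf_le_right : P.1 ⊓ Q.1 ≤ Q.1)
    have hz : (Δ.chart R).map fP x ∈ Set.range ((Δ.chart R).map (gP ≫ fP)) := by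
      have := (range_affineChartMap_inter R (Δ.isConvexCone _ K.2).fg hP hQ).subset
      exact this ⟨⟨x, rfl⟩, ⟨y, hxy.symm⟩⟩
    obtain ⟨z, hz⟩ := hz
    refine ⟨L, gP, gQ, z, ?_, ?_⟩
    · apply ((Δ.chart R).map fP).isOpenEmbedding.injective
      rw [← hz, Functor.map_comp]
      rfl
    · apply ((Δ.chart R).map fQ).isOpenEmbedding.injective
      refine Eq.trans ?_ (hz.trans hxy)
      rw [show gP ≫ fP = gQ ≫ fQ from rfl, Functor.map_comp]
      rfl

/-- The toric scheme `X_Δ(R)`: the affine schemes `U_P = Spec R[Pˇ]`, for `P ∈ Δ`, glued along the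
open subschemes `U_{P ∩ Q}` of `U_P` and `U_Q`.  It is the colimit, in the category of schemes, of
the diagram of the `U_P` and the open immersions `U_P ⟶ U_Q` for `P ⊆ Q` in `Δ`. -/
noncomputable def toricScheme : Scheme.{max u v} :=
  colimit (Δ.chart R)

/-- The canonical morphism `U_P ⟶ X_Δ(R)`. -/
noncomputable def toricι (P : Δ.cones) : affineChart R P.1 ⟶ Δ.toricScheme R :=
  colimit.ι (Δ.chart R) P

instance (P : Δ.cones) : IsOpenImmersion (Δ.toricι R P) :=
  inferInstanceAs (IsOpenImmersion (colimit.ι (Δ.chart R) P))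

/-- The open subschemes `U_P` cover `X_Δ(R)`. -/
lemma iUnion_range_toricι : ⋃ P, Set.range (Δ.toricι R P) = Set.univ := by
  refine Set.eq_univ_of_forall fun x => ?_
  obtain ⟨P, y, hy⟩ := Scheme.IsLocallyDirected.ι_jointly_surjective (Δ.chart R) x
  exact Set.mem_iUnion.2 ⟨P, y, hy⟩

/-- In `X_Δ(R)`, one has `U_P ∩ U_Q = U_{P ∩ Q}`. -/
lemma range_toricι_inter (P Q : Δ.cones) :
    Set.range (Δ.toricι R P) ∩ Set.range (Δ.toricι R Q) =
      Set.range (Δ.toricι R ⟨P.1 ⊓ Q.1, Δ.inf_mem P.2 Q.2⟩) := by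
  have hsub : ∀ {K L : Δ.cones} (f : K ⟶ L),
      Set.range (Δ.toricι R K) ⊆ Set.range (Δ.toricι R L) := by
    rintro K L f _ ⟨x, rfl⟩
    refine ⟨(Δ.chart R).map f x, ?_⟩
    change (colimit.ι (Δ.chart R) L) ((Δ.chart R).map f x) = colimit.ι (Δ.chart R) K x
    rw [← colimit.w (Δ.chart R) f]
    rfl
  apply Set.Subset.antisymm
  · rintro _ ⟨⟨x, rfl⟩, ⟨y, hy⟩⟩
    obtain ⟨K, fP, fQ, z, rfl, rfl⟩ :=
      (Scheme.IsLocallyDirected.ι_eq_ι_iff (Δ.chart R)).1 hy.symm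
    let g : K ⟶ (⟨P.1 ⊓ Q.1, Δ.inf_mem P.2 Q.2⟩ : Δ.cones) :=
      homOfLE (le_inf fP.le fQ.le : K.1 ≤ P.1 ⊓ Q.1)
    apply hsub g
    refine ⟨z, ?_⟩
    change colimit.ι (Δ.chart R) K z = colimit.ι (Δ.chart R) P ((Δ.chart R).map fP z)
    rw [← colimit.w (Δ.chart R) fP]
    rfl
  · exact Set.subset_inter (hsub (homOfLE (inf_le_left : P.1 ⊓ Q.1 ≤ P.1)))
      (hsub (homOfLE (inf_le_right : P.1 ⊓ Q.1 ≤ Q.1)))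

end Fan

end Scheme

end ToricScheme

namespace ToricScheme

open CategoryTheory CategoryTheory.Limits AlgebraicGeometry

/-! ### Faces, duals and a character of finitely generated monoids. -/

section Lattice

variable {G : Type v} [AddCommGroup G]

/-! Everything reduces to a combinatorial fact about covers: a chart `U_Q` has a point that belongs
to no smaller chart. It is the torus-fixed point of `U_Q` in a fibre over `Spec R` (`R` is nonzero),
namely the pullback of a prime of `R` along the character of `Qˇ` that is 1 on functionals vanishing
on `Q` and 0 on all others. A proper face `F` of `Q` has a supporting functional sent to 0, and
`U_F` is the locus where this functional is invertible, so the point avoids `U_F`. Since `U_Q ∩ U_P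
= U_{Q ∩ P}`, a family of charts covering `U_Q` must contain some `U_P` with `Q ≤ P`
(`exists_le_of_range_toricι_subset`).

If the scheme is quasi-compact, finitely many charts cover it, so every cone of the fan is a face of
one of finitely many cones. Each of these has finitely many faces, because a face is generated by
the generators it contains (`finite_setOf_isFace`); hence the fan is finite.

Conversely, Gordan's lemma (`dualCone_fg`) makes each `R[Pˇ]` a finitely generated algebra over the
noetherian ring `R`, so the scheme is always locally noetherian; a finite fan makes it a finite
union of affine, hence compact, charts. -/

lemma IsFace.eq_closure_inter {S : Set G} {F : AddSubmonoid G}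
    (h : IsFace F (AddSubmonoid.closure S)) : F = AddSubmonoid.closure (S ∩ F) := by
  refine le_antisymm (fun x hx => ?_) (AddSubmonoid.closure_le.2 Set.inter_subset_right)
  have hxS := h.le hx
  induction hxS using AddSubmonoid.closure_induction with
  | mem x hxS => exact AddSubmonoid.subset_closure ⟨hxS, hx⟩
  | zero => exact zero_mem _
  | add x y hxS hyS ihx ihy =>
    -- A sum lying in a face has both summands in it, so writing an element of `F` in the generators
    -- `S` uses only those in `F`.
    exact add_mem (ihx (h.mem_left hxS hyS hx))
      (ihy (h.mem_left hyS hxS (by rwa [add_comm])))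

/-- A finitely generated monoid has only finitely many faces. -/
lemma finite_setOf_isFace {P : AddSubmonoid G} (hP : P.FG) : {F | IsFace F P}.Finite := by
  obtain ⟨S, rfl⟩ := hP
  refine (S.finite_toSet.finite_subsets.image AddSubmonoid.closure).subset fun F hF => ?_
  exact ⟨S ∩ F, Set.inter_subset_left, hF.eq_closure_inter.symm⟩

/-- **Gordan's lemma**: the dual of a finitely generated monoid in a lattice is finitely
generated. -/
lemma dualCone_fg [Module.Free ℤ G] [Module.Finite ℤ G] {P : AddSubmonoid G} (hP : P.FG) :
    (dualCone P).FG := by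
  classical
  obtain ⟨S, rfl⟩ := hP
  let b := Module.Free.chooseBasis ℤ (G →ₗ[ℤ] ℤ)
  let ι := Module.Free.ChooseBasisIndex ℤ (G →ₗ[ℤ] ℤ)
  -- A functional is written as `u m - u n` with natural coordinates, and nonnegativity on the
  -- generators becomes an equation with slack variables `k`: its value at `s` is `k s`. The dual is
  -- thus the image of the equalizer of two homomorphisms out of a free commutative monoid of finite
  -- rank, and such an equalizer is finitely generated.
  let u : (ι → ℕ) →+ (G →ₗ[ℤ] ℤ) := (Fintype.linearCombination ℕ b).toAddMonoidHom
  let e : (G →ₗ[ℤ] ℤ) →+ (S → ℤ) :=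
    { toFun := fun σ s => σ s, map_zero' := rfl, map_add' := fun _ _ => rfl }
  let c : (S → ℕ) →+ (S → ℤ) :=
    { toFun := fun n s => n s, map_zero' := by ext; simp, map_add' := fun _ _ => by ext; simp }
  let f : (ι → ℕ) × (ι → ℕ) × (S → ℕ) →+ (S → ℤ) := (e.comp u).comp (AddMonoidHom.fst _ _)
  let g : (ι → ℕ) × (ι → ℕ) × (S → ℕ) →+ (S → ℤ) :=
    ((e.comp u).coprod c).comp (AddMonoidHom.snd _ _)
  let h : (ι → ℕ) × (ι → ℕ) × (S → ℕ) →+ (G →ₗ[ℤ] ℤ) :=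
    u.comp (AddMonoidHom.fst _ _) -
      u.comp ((AddMonoidHom.fst _ _).comp (AddMonoidHom.snd _ _))
  suffices heq : dualCone (AddSubmonoid.closure (S : Set G)) = (f.eqLocusM g).map h by
    rw [heq]
    exact (AddSubmonoid.fg_eqLocusM f g).map h
  have hu : ∀ n, u n = ∑ i, n i • b i := fun _ => rfl
  ext σ
  constructor
  · intro hσ
    have hσu : u (fun i => (b.repr σ i).toNat) - u (fun i => (-b.repr σ i).toNat) = σ := by
      rw [hu, hu, ← Finset.sum_sub_distrib]
      conv_rhs => rw [← b.sum_repr σ]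
      refine Finset.sum_congr rfl fun i _ => ?_
      rw [← natCast_zsmul, ← natCast_zsmul, ← sub_smul, Int.toNat_sub_toNat_neg]
    -- Positive and negative parts of the coordinates; the slack is the value of `σ` on each
    -- generator, where truncation loses nothing because `σ` is nonnegative there.
    refine ⟨(fun i => (b.repr σ i).toNat, fun i => (-b.repr σ i).toNat,
      fun s => (σ s).toNat), ?_, hσu⟩
    change e (u fun i => (b.repr σ i).toNat) =
      e (u fun i => (-b.repr σ i).toNat) + c fun s => (σ s).toNat
    rw [← sub_eq_iff_eq_add', ← map_sub, hσu]
    ext s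
    exact (Int.toNat_of_nonneg (hσ s (AddSubmonoid.subset_closure s.2))).symm
  · rintro ⟨⟨m, n, k⟩, hmnk, rfl⟩ x hx
    change 0 ≤ (u m - u n) x
    replace hmnk : e (u m) = e (u n) + c k := hmnk
    induction hx using AddSubmonoid.closure_induction with
    | mem x hx =>
      have h1 : u m x = u n x + k ⟨x, hx⟩ := congrFun hmnk ⟨x, hx⟩
      rw [LinearMap.sub_apply, h1]
      omega
    | zero => simp
    | add x y _ _ hx hy => rw [map_add]; exact add_nonneg hx hy

open Classical in
/-- The indicator function of the submonoid of functionals vanishing on `P`, as a multiplicative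
character of the dual monoid of `P`. -/
noncomputable def vanishingCharacter (R : Type u) [CommRing R] (P : AddSubmonoid G) :
    Multiplicative (dualCone P) →* R where
  toFun τ := if ∀ x ∈ P, τ.toAdd.1 x = 0 then 1 else 0
  map_one' := if_pos fun _ _ => rfl
  map_mul' σ τ := by
    -- The functionals vanishing on `P` form a face of the dual monoid, which is what
    -- multiplicativity of the indicator requires.
    have h : (∀ x ∈ P, (σ * τ).toAdd.1 x = 0) ↔
        (∀ x ∈ P, σ.toAdd.1 x = 0) ∧ ∀ x ∈ P, τ.toAdd.1 x = 0 := by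
      rw [← forall₂_and]
      exact forall₂_congr fun x hx =>
        add_eq_zero_iff_of_nonneg (σ.toAdd.2 x hx) (τ.toAdd.2 x hx)
    simp only [h, ite_and, mul_ite, mul_one, mul_zero]
    split_ifs <;> rfl

end Lattice

/-! ### The affine charts. -/

section Scheme

variable {G : Type v} [AddCommGroup G] (R : Type u) [CommRing R]

/-- Some point of `U_P` lies in no `U_F`, for `F` a proper face of `P`. -/
lemma exists_notMem_range_affineChartMap [Nontrivial R] [Module.Free ℤ G] [Module.Finite ℤ G]
    {P : AddSubmonoid G} (hP : P.FG) : ∃ x : affineChart R P,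
      ∀ (F : AddSubmonoid G) (hF : IsFace F P), F ≠ P →
        x ∉ Set.range (affineChartMap R hF.le) := by
  let φ := (AddMonoidAlgebra.lift R R (dualCone P) (vanishingCharacter R P)).toRingHom
  obtain ⟨y⟩ := (inferInstance : Nonempty (PrimeSpectrum R))
  refine ⟨PrimeSpectrum.comap φ y, fun F hF hne hx => ?_⟩
  obtain ⟨σ, hσ⟩ := hF.exists_isSupporting hP
  have hy := (range_comap_dualMap R hP hF.le hσ).subset hx
  refine hy ?_
  change φ _ ∈ y.asIdeal
  -- An element of `P` outside `F` shows that `σ` does not vanish on all of `P`, so the character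
  -- kills it.
  obtain ⟨q, hqP, hqF⟩ := SetLike.exists_of_lt (lt_of_le_of_ne hF.le hne)
  have h0 : φ (AddMonoidAlgebra.single (⟨σ, hσ.mem_dualCone⟩ : dualCone P) 1) = 0 := by
    change AddMonoidAlgebra.lift R R (dualCone P) (vanishingCharacter R P) _ = 0
    rw [AddMonoidAlgebra.lift_single, one_smul]
    exact if_neg fun h => (hσ.pos q hqP hqF).ne' (h q hqP)
  rw [h0]
  exact y.asIdeal.zero_mem

instance (P : AddSubmonoid G) : IsAffine (affineChart R P) :=
  inferInstanceAs (IsAffine (Spec _))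

/-- Gordan's lemma makes the monoid algebra of finite type over `R`, and Hilbert's basis theorem
applies. -/
lemma isLocallyNoetherian_affineChart [IsNoetherianRing R] [Module.Free ℤ G]
    [Module.Finite ℤ G] {P : AddSubmonoid G} (hP : P.FG) :
    IsLocallyNoetherian (affineChart R P) := by
  have : AddMonoid.FG (dualCone P) := (AddMonoid.fg_iff_addSubmonoid_fg _).2 (dualCone_fg hP)
  have : IsNoetherianRing (AddMonoidAlgebra R (dualCone P)) :=
    Algebra.FiniteType.isNoetherianRing R _
  exact isLocallyNoetherian_Spec.2 this

/-! ### Compactness and noetherianity of the glued scheme. -/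

namespace Fan

variable (Δ : Fan G) [Module.Free ℤ G] [Module.Finite ℤ G]

lemma isLocallyNoetherian_toricScheme [IsNoetherianRing R] :
    IsLocallyNoetherian (Δ.toricScheme R) :=
  (isLocallyNoetherian_iff_openCover (Scheme.IsLocallyDirected.openCover (Δ.chart R))).2
    fun P => isLocallyNoetherian_affineChart R (Δ.isConvexCone _ P.2).fg

lemma compactSpace_toricScheme (h : Δ.cones.Finite) : CompactSpace (Δ.toricScheme R) := by
  have := h.to_subtype
  rw [← isCompact_univ_iff, ← Δ.iUnion_range_toricι R]
  exact isCompact_iUnion fun P => isCompact_range (Δ.toricι R P).continuous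

/-- If the `U_P`, for `P` in a set of cones, cover `U_Q`, then `Q` is a subcone of one of these
cones. -/
lemma exists_le_of_range_toricι_subset [Nontrivial R] {t : Set Δ.cones} {Q : Δ.cones}
    (h : Set.range (Δ.toricι R Q) ⊆ ⋃ P ∈ t, Set.range (Δ.toricι R P)) : ∃ P ∈ t, Q ≤ P := by
  obtain ⟨x, hx⟩ := exists_notMem_range_affineChartMap R (Δ.isConvexCone _ Q.2).fg
  obtain ⟨P, hPt, hxP⟩ := Set.mem_iUnion₂.1 (h ⟨x, rfl⟩)
  refine ⟨P, hPt, ?_⟩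
  by_contra hle
  have hF := (Δ.inter_isFace Q.1 Q.2 P.1 P.2).1
  -- If `Q` is not contained in `P`, then `Q ⊓ P` is a proper face of `Q`, so the special point `x`
  -- would have to avoid its chart.
  refine hx _ hF (fun heq => hle (inf_eq_left.1 heq)) ?_
  obtain ⟨z, hz⟩ := (Δ.range_toricι_inter R Q P).subset ⟨⟨x, rfl⟩, hxP⟩
  let i : (⟨Q.1 ⊓ P.1, Δ.inf_mem Q.2 P.2⟩ : Δ.cones) ⟶ Q :=
    homOfLE (inf_le_left : Q.1 ⊓ P.1 ≤ Q.1)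
  -- The equality of points is known in the glued scheme; injectivity of `U_Q ⟶ X` brings it back to
  -- `U_Q`.
  refine ⟨z, (Δ.toricι R Q).isOpenEmbedding.injective (Eq.trans ?_ hz)⟩
  change (colimit.ι (Δ.chart R) Q) ((Δ.chart R).map i z) = colimit.ι (Δ.chart R) _ z
  rw [← colimit.w (Δ.chart R) i]
  rfl

/-- The cones of a finite subcover dominate the whole fan, and in a fan a subcone is a face, so the
finitely many faces of those cones exhaust it. -/
lemma finite_of_compactSpace_toricScheme [Nontrivial R] [CompactSpace (Δ.toricScheme R)] :
    Δ.cones.Finite := by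
  obtain ⟨t, ht⟩ := isCompact_univ.elim_finite_subcover
    (fun P => Set.range (Δ.toricι R P)) (fun P => (Δ.toricι R P).isOpenEmbedding.isOpen_range)
    (Δ.iUnion_range_toricι R).ge
  refine (t.finite_toSet.biUnion fun P _ =>
    finite_setOf_isFace (Δ.isConvexCone _ P.2).fg).subset fun Q hQ => ?_
  obtain ⟨P, hPt, hle⟩ := Δ.exists_le_of_range_toricι_subset R (t := t) (Q := ⟨Q, hQ⟩)
    ((Set.subset_univ _).trans ht)
  exact Set.mem_biUnion hPt (isFace_of_le hQ P.2 hle)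

end Fan

end Scheme

end ToricScheme

theorem theoremt4654 {G : Type v} [AddCommGroup G] [Module.Free ℤ G] [Module.Finite ℤ G]
    (R : Type u) [CommRing R] [Nontrivial R] [IsNoetherianRing R] (Δ : ToricScheme.Fan G) :
    List.TFAE [CompactSpace (Δ.toricScheme R),
      AlgebraicGeometry.IsNoetherian (Δ.toricScheme R),
      Δ.cones.Finite] := by
  tfae_have 1 → 3 := fun _ => Δ.finite_of_compactSpace_toricScheme R
  tfae_have 3 → 2 := fun h =>
    { toIsLocallyNoetherian := Δ.isLocallyNoetherian_toricScheme R
      toCompactSpace := Δ.compactSpace_toricScheme R h }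
  tfae_have 2 → 1 := fun h => h.toCompactSpace
  tfae_finish
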